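/- Let $\Sigma$ be a $\sigma$-finite measure space, let $L^2(\Sigma)$ be its complex $L^2$-space, and for $f\in L^2(\Sigma^2)$ let $S_f\in B(L^2(\Sigma))$ be the Hilbert--Schmidt operator with kernel $f$, $(S_fh)(s)=\int_\Sigma f(s,t)h(t)\,dt$. For $\varphi\in L^\infty(\Sigma^2)$ let $M_\varphi$ be the operator $S_f\mapsto S_{\varphi f}$ on the Hilbert--Schmidt operators of $L^2(\Sigma)$. Let $H$ be a complex Hilbert space, with inner product linear in the first variable, and let $\alpha,\beta\in L^\infty(\Sigma,H)$ (Bochner space) be such that $$\varphi(s,t)=\langle\alpha(s),\beta(t)\rangle_H\quad\text{for almost every }(s,t)\in\Sigma\times\Sigma.$$ Then $M_\varphi$ has a unique $w^*$-continuous linear extension $M_\varphi^\infty:B(L^2(\Sigma))\to B(L^2(\Sigma))$, where the $w^*$-topology is that of $B(L^2(\Sigma))$ as the dual of the trace class operators, and $M_\varphi^\infty$ is unital (that is, $M_\varphi^\infty(I)=I$) if and only if $$\langle\alpha(t),\beta(t)\rangle_H=1\quad\text{for almost every }t\in\Sigma.$$ -/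

import Mathlib

open MeasureTheory
open scoped ENNReal Topology

namespace SchurMult

section KernelOperator

variable {Ω : Type*} [MeasurableSpace Ω] {μ : Measure Ω} [SigmaFinite μ]

theorem lintegral_enorm_kernel_sq_le {f : Ω × Ω → ℂ} {h : Ω → ℂ}
    (hf : MemLp f 2 (μ.prod μ)) (hh : MemLp h 2 μ) :
    ∫⁻ s, ‖∫ t, f (s, t) * h t ∂μ‖ₑ ^ (2 : ℝ) ∂μ ≤
      (∫⁻ p, ‖f p‖ₑ ^ (2 : ℝ) ∂(μ.prod μ)) * ∫⁻ t, ‖h t‖ₑ ^ (2 : ℝ) ∂μ := by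
  have hfm := hf.aestronglyMeasurable
  have hhm := hh.aestronglyMeasurable
  have hne : ∫⁻ t, ‖h t‖ₑ ^ (2 : ℝ) ∂μ ≠ ∞ := by
    have := (eLpNorm_lt_top_iff_lintegral_rpow_enorm_lt_top (by norm_num) (by norm_num)).1
      hh.eLpNorm_lt_top
    simpa using this.ne
  rw [lintegral_prod _ (hfm.enorm.pow_const _), ← lintegral_mul_const' _ _ hne]
  refine lintegral_mono_ae ?_
  filter_upwards [hfm.prodMk_left] with s hs
  have h1 : ‖∫ t, f (s, t) * h t ∂μ‖ₑ ≤
      (∫⁻ t, ‖f (s, t)‖ₑ ^ (2 : ℝ) ∂μ) ^ (1 / (2 : ℝ)) *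
        (∫⁻ t, ‖h t‖ₑ ^ (2 : ℝ) ∂μ) ^ (1 / (2 : ℝ)) := by
    refine (enorm_integral_le_lintegral_enorm _).trans ?_
    simp only [enorm_mul]
    exact ENNReal.lintegral_mul_le_Lp_mul_Lq μ Real.HolderConjugate.two_two hs.enorm hhm.enorm
  calc _ ≤ _ := ENNReal.rpow_le_rpow h1 (by norm_num)
    _ = _ := by
      rw [ENNReal.mul_rpow_of_nonneg _ _ (by norm_num), ← ENNReal.rpow_mul, ← ENNReal.rpow_mul]
      norm_num

theorem aestronglyMeasurable_kernel {f : Ω × Ω → ℂ} {h : Ω → ℂ}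
    (hf : MemLp f 2 (μ.prod μ)) (hh : MemLp h 2 μ) :
    AEStronglyMeasurable (fun s => ∫ t, f (s, t) * h t ∂μ) μ :=
  (hf.aestronglyMeasurable.mul
    hh.aestronglyMeasurable.comp_snd).integral_prod_right'

theorem eLpNorm_kernel_le {f : Ω × Ω → ℂ} {h : Ω → ℂ}
    (hf : MemLp f 2 (μ.prod μ)) (hh : MemLp h 2 μ) :
    eLpNorm (fun s => ∫ t, f (s, t) * h t ∂μ) 2 μ ≤
      eLpNorm f 2 (μ.prod μ) * eLpNorm h 2 μ := by
  simp only [eLpNorm_eq_lintegral_rpow_enorm_toReal (p := 2) (by norm_num) (by norm_num),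
    ENNReal.toReal_ofNat]
  rw [← ENNReal.mul_rpow_of_nonneg _ _ (by norm_num)]
  exact ENNReal.rpow_le_rpow (lintegral_enorm_kernel_sq_le hf hh) (by norm_num)

theorem memLp_kernel {f : Ω × Ω → ℂ} {h : Ω → ℂ}
    (hf : MemLp f 2 (μ.prod μ)) (hh : MemLp h 2 μ) :
    MemLp (fun s => ∫ t, f (s, t) * h t ∂μ) 2 μ :=
  ⟨aestronglyMeasurable_kernel hf hh, (eLpNorm_kernel_le hf hh).trans_lt
    (ENNReal.mul_lt_top hf.eLpNorm_lt_top hh.eLpNorm_lt_top)⟩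

theorem ae_integrable_kernel {f : Ω × Ω → ℂ} {h : Ω → ℂ}
    (hf : MemLp f 2 (μ.prod μ)) (hh : MemLp h 2 μ) :
    ∀ᵐ s ∂μ, Integrable (fun t => f (s, t) * h t) μ := by
  have h2 := (eLpNorm_lt_top_iff_lintegral_rpow_enorm_lt_top (by norm_num) (by norm_num)).1
      hf.eLpNorm_lt_top
  rw [lintegral_prod _ (hf.aestronglyMeasurable.enorm.pow_const _)] at h2
  have h3 := ae_lt_top' (hf.aestronglyMeasurable.enorm.pow_const _).lintegral_prod_right' h2.ne
  filter_upwards [h3, hf.aestronglyMeasurable.prodMk_left] with s hs hm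
  have : MemLp (fun t => f (s, t)) 2 μ :=
    ⟨hm, (eLpNorm_lt_top_iff_lintegral_rpow_enorm_lt_top (by norm_num) (by norm_num)).2 hs⟩
  exact this.integrable_mul hh

/-- The function `S_f h = ∫ f(·, t) h(t) dt` in `L²(Ω)`, for `f ∈ L²(Ω × Ω)` and `h ∈ L²(Ω)`. -/
noncomputable def kernelFun (f : Lp ℂ 2 (μ.prod μ)) (h : Lp ℂ 2 μ) : Lp ℂ 2 μ :=
  (memLp_kernel (Lp.memLp f) (Lp.memLp h)).toLp (fun s => ∫ t, f (s, t) * h t ∂μ)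

theorem kernelFun_add (f : Lp ℂ 2 (μ.prod μ)) (h k : Lp ℂ 2 μ) :
    kernelFun f (h + k) = kernelFun f h + kernelFun f k := by
  unfold kernelFun
  rw [← MemLp.toLp_add]
  refine MemLp.toLp_congr _ _ ?_
  filter_upwards [ae_integrable_kernel (Lp.memLp f) (Lp.memLp h),
    ae_integrable_kernel (Lp.memLp f) (Lp.memLp k)] with s hs ks
  rw [Pi.add_apply, ← integral_add hs ks]
  refine integral_congr_ae ?_
  filter_upwards [Lp.coeFn_add h k] with t ht
  rw [ht, Pi.add_apply, mul_add]

theorem kernelFun_smul (f : Lp ℂ 2 (μ.prod μ)) (c : ℂ) (h : Lp ℂ 2 μ) :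
    kernelFun f (c • h) = c • kernelFun f h := by
  unfold kernelFun
  rw [← MemLp.toLp_const_smul]
  refine MemLp.toLp_congr _ _ (Filter.Eventually.of_forall fun s => ?_)
  simp only [Pi.smul_apply, smul_eq_mul]
  rw [← integral_const_mul]
  refine integral_congr_ae ?_
  filter_upwards [Lp.coeFn_smul c h] with t ht
  rw [ht, Pi.smul_apply, smul_eq_mul]
  ring

theorem norm_kernelFun_le (f : Lp ℂ 2 (μ.prod μ)) (h : Lp ℂ 2 μ) :
    ‖kernelFun f h‖ ≤ ‖f‖ * ‖h‖ := by
  unfold kernelFun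
  rw [Lp.norm_toLp, Lp.norm_def, Lp.norm_def, ← ENNReal.toReal_mul]
  exact ENNReal.toReal_mono
    (ENNReal.mul_ne_top (Lp.eLpNorm_ne_top f) (Lp.eLpNorm_ne_top h))
    (eLpNorm_kernel_le (Lp.memLp f) (Lp.memLp h))

/-- The Hilbert-Schmidt operator `S_f` on `L²(Ω)` with kernel `f ∈ L²(Ω × Ω)`:
`(S_f h)(s) = ∫ f(s, t) h(t) dt`. -/
noncomputable def kernelOp (f : Lp ℂ 2 (μ.prod μ)) : Lp ℂ 2 μ →L[ℂ] Lp ℂ 2 μ :=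
  LinearMap.mkContinuous
    { toFun := kernelFun f
      map_add' := kernelFun_add f
      map_smul' := kernelFun_smul f }
    ‖f‖ (norm_kernelFun_le f)

end KernelOperator

section WStar

variable {K : Type*} [NormedAddCommGroup K] [InnerProductSpace ℂ K]

/-- The `w*`-topology (σ-weak topology) of `B(K)`, as the dual of the trace class: the coarsest
topology for which the functionals `x ↦ tr(xρ)` are continuous for all trace class operators
`ρ = ∑ₙ ⟨·, gₙ⟩ fₙ` with `∑ ‖fₙ‖² < ∞` and `∑ ‖gₙ‖² < ∞`,
that is, `tr(xρ) = ∑ₙ ⟨x fₙ, gₙ⟩`. -/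
@[reducible] noncomputable def wStarTopology (K : Type*) [NormedAddCommGroup K] [InnerProductSpace ℂ K] :
    TopologicalSpace (K →L[ℂ] K) :=
  ⨅ (f : ℕ → K) (g : ℕ → K) (_ : Summable fun n => ‖f n‖ ^ 2) (_ : Summable fun n => ‖g n‖ ^ 2),
    TopologicalSpace.induced (fun x : K →L[ℂ] K => ∑' n, inner ℂ (g n) (x (f n))) inferInstance

/-- Continuity of a map `B(K) → B(K)` for the `w*`-topology on both sides. -/
def IsWStarContinuous (T : (K →L[ℂ] K) → (K →L[ℂ] K)) : Prop :=
  Continuous[wStarTopology K, wStarTopology K] T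

end WStar

variable {Ω : Type*} [MeasurableSpace Ω] {μ : Measure Ω} [SigmaFinite μ]

/-- `T` is a `w*`-continuous linear extension to `B(L²(Ω))` of the operator
`M_φ : S_f ↦ S_{φ f}` on the Hilbert-Schmidt operators of `L²(Ω)`. -/
structure IsWStarExtension (φ : Lp ℂ ∞ (μ.prod μ))
    (T : (Lp ℂ 2 μ →L[ℂ] Lp ℂ 2 μ) →ₗ[ℂ] (Lp ℂ 2 μ →L[ℂ] Lp ℂ 2 μ)) : Prop where
  wStarContinuous : IsWStarContinuous T
  extends_schur : ∀ f : Lp ℂ 2 (μ.prod μ),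
    T (kernelOp f) = kernelOp (φ • f : Lp ℂ 2 (μ.prod μ))

end SchurMult

/-!
Let `e` be a countable orthonormal family whose closed span contains the essential range of `α`,
which is separable. Then `⟨α s, β t⟩ = ∑ᵢ ⟨α s, e i⟩ ⟨e i, β t⟩`, so on Hilbert-Schmidt operators
`M_φ` is `T ↦ V_α* (T ⊗ 1) V_β`, where `V_γ : L² → ℓ²(ι, L²)` multiplies by the conjugated
coordinates of `γ` and is bounded by Bessel's inequality. This formula makes sense for every bounded
`T` and is `w*`-continuous because composing it with the functional of a trace class operator gives
the functional of another one. At `T = 1` it is multiplication by `t ↦ ⟨α t, β t⟩`. The extension is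
unique since rank one operators are Hilbert-Schmidt and their span is `w*`-dense.
-/

namespace SchurMult

open Filter ContinuousLinearMap

section Sequences

variable {𝕜 : Type*} [NontriviallyNormedField 𝕜] {E F : Type*}
  [NormedAddCommGroup E] [NormedSpace 𝕜 E] [NormedAddCommGroup F] [NormedSpace 𝕜 F] {ι κ : Type*}

theorem summable_norm_mul_norm {f : ι → E} {g : ι → F} (hf : Summable fun n => ‖f n‖ ^ 2)
    (hg : Summable fun n => ‖g n‖ ^ 2) : Summable fun n => ‖f n‖ * ‖g n‖ :=
  (hf.add hg).of_nonneg_of_le (fun _ => by positivity) fun n => by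
    nlinarith [two_mul_le_add_sq ‖f n‖ ‖g n‖, mul_nonneg (norm_nonneg (f n)) (norm_nonneg (g n))]

theorem hasSum_norm_sq (x : lp (fun _ : ι => E) 2) : HasSum (fun i => ‖x i‖ ^ 2) (‖x‖ ^ 2) := by
  simpa using lp.hasSum_norm (by norm_num) x

theorem summable_norm_sq_prod {x : κ → lp (fun _ : ι => E) 2}
    (hx : Summable fun n => ‖x n‖ ^ 2) : Summable fun p : κ × ι => ‖x p.1 p.2‖ ^ 2 := by
  rw [summable_prod_of_nonneg fun _ => by positivity]
  exact ⟨fun n => (hasSum_norm_sq (x n)).summable,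
    by simpa only [(hasSum_norm_sq (x _)).tsum_eq] using hx⟩

theorem summable_norm_sq_apply {f : ι → E} (hf : Summable fun n => ‖f n‖ ^ 2) (T : E →L[𝕜] F) :
    Summable fun n => ‖T (f n)‖ ^ 2 :=
  (hf.mul_left (‖T‖ ^ 2)).of_nonneg_of_le (fun _ => by positivity) fun n => by
    rw [← mul_pow]
    exact pow_le_pow_left₀ (norm_nonneg _) (T.le_opNorm _) 2

/-- The column operator `x ↦ (cᵢ x)ᵢ` into `ℓ²(ι, F)` of a family `c` whose partial sums satisfy a
Bessel-type bound with constant `C`. -/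
noncomputable def column (c : ι → E →L[𝕜] F) {C : ℝ} (hC : 0 ≤ C)
    (hc : ∀ (s : Finset ι) (x : E), ∑ i ∈ s, ‖c i x‖ ^ 2 ≤ (C * ‖x‖) ^ 2) :
    E →L[𝕜] lp (fun _ : ι => F) 2 :=
  LinearMap.mkContinuous
    { toFun x := ⟨fun i => c i x, memℓp_gen' (C := (C * ‖x‖) ^ 2) (by simpa using (hc · x))⟩
      map_add' x y := by ext i; exact map_add (c i) x y
      map_smul' z x := by ext i; exact map_smul (c i) z x }
    C fun x => lp.norm_le_of_forall_sum_le (by norm_num) (by positivity) (by simpa using (hc · x))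

/-- The amplification `T ⊗ 1`, which applies `T` in each coordinate of an `ℓ²`-family. -/
noncomputable def amplify (ι : Type*) (T : E →L[𝕜] F) :
    lp (fun _ : ι => E) 2 →L[𝕜] lp (fun _ : ι => F) 2 :=
  column (fun i => T ∘L lp.evalCLM 𝕜 _ 2 i) (norm_nonneg T) fun s x =>
    calc ∑ i ∈ s, ‖T (x i)‖ ^ 2 ≤ ∑ i ∈ s, ‖T‖ ^ 2 * ‖x i‖ ^ 2 := by
          refine Finset.sum_le_sum fun i _ => ?_
          rw [← mul_pow]
          exact pow_le_pow_left₀ (norm_nonneg _) (T.le_opNorm _) 2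
      _ ≤ (‖T‖ * ‖x‖) ^ 2 := by
          rw [← Finset.mul_sum, mul_pow]
          gcongr
          exact sum_le_hasSum s (fun _ _ => by positivity) (hasSum_norm_sq x)

end Sequences

section Sandwich

variable {𝕜 : Type*} [RCLike 𝕜] {E F E' F' : Type*}
  [NormedAddCommGroup E] [InnerProductSpace 𝕜 E] [CompleteSpace E]
  [NormedAddCommGroup F] [InnerProductSpace 𝕜 F] [CompleteSpace F]
  [NormedAddCommGroup E'] [NormedSpace 𝕜 E'] [NormedAddCommGroup F'] [NormedSpace 𝕜 F']
  {ι : Type*}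

/-- The map `T ↦ V* (T ⊗ 1) W` between operator spaces. -/
noncomputable def sandwich (V : E →L[𝕜] lp (fun _ : ι => F) 2)
    (W : E' →L[𝕜] lp (fun _ : ι => F') 2) : (F' →L[𝕜] F) →ₗ[𝕜] (E' →L[𝕜] E) where
  toFun T := adjoint V ∘L amplify ι T ∘L W
  map_add' S T := by
    rw [← comp_add, ← add_comp]
    rfl
  map_smul' z T := by
    rw [RingHom.id_apply, ← comp_smul, ← smul_comp]
    rfl

theorem hasSum_inner_sandwich (V : E →L[𝕜] lp (fun _ : ι => F) 2)
    (W : E' →L[𝕜] lp (fun _ : ι => F') 2) (T : F' →L[𝕜] F) (k : E) (h : E') :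
    HasSum (fun i => inner 𝕜 (V k i) (T (W h i))) (inner 𝕜 k (sandwich V W T h)) := by
  change HasSum _ (inner 𝕜 k (adjoint V (amplify ι T (W h))))
  rw [adjoint_inner_right]
  exact lp.hasSum_inner _ _

end Sandwich

section Orthonormal

variable {𝕜 : Type*} [RCLike 𝕜] {H : Type*} [NormedAddCommGroup H] [InnerProductSpace 𝕜 H]
  {ι : Type*} {e : ι → H}

theorem norm_sum_inner_smul_le (he : Orthonormal 𝕜 e) (s : Finset ι) (x : H) :
    ‖∑ i ∈ s, inner 𝕜 (e i) x • e i‖ ≤ ‖x‖ := by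
  rw [← sq_le_sq₀ (norm_nonneg _) (norm_nonneg _)]
  have h := he.orthogonalFamily.norm_sum (fun i => inner 𝕜 (e i) x) s
  simp only [LinearIsometry.toSpanSingleton_apply] at h
  exact h.trans_le (he.sum_inner_products_le x)

theorem countable_of_orthonormal [TopologicalSpace.SeparableSpace H] (he : Orthonormal 𝕜 e) :
    Countable ι := by
  obtain ⟨d, hd, hdense⟩ := TopologicalSpace.exists_countable_dense H
  have hcount (y : H) : {i | inner 𝕜 (e i) y ≠ 0}.Countable := by
    simpa [Function.support] using (he.inner_products_summable y).countable_support
  refine Set.countable_univ_iff.1 ((hd.biUnion fun y _ => hcount y).mono fun i _ => ?_)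
  by_contra hi
  have horth : ∀ y ∈ d, inner 𝕜 (e i) y = 0 := by simpa using hi
  exact he.ne_zero i (hdense.eq_zero_of_inner_left (𝕜 := 𝕜) horth)

theorem exists_countable_orthonormal_hasSum.{u, v} {𝕜 : Type u} [RCLike 𝕜] {H : Type v}
    [NormedAddCommGroup H] [InnerProductSpace 𝕜 H] [CompleteSpace H] {t : Set H}
    (ht : TopologicalSpace.IsSeparable t) :
    ∃ (ι : Type v) (_ : Countable ι) (e : ι → H), Orthonormal 𝕜 e ∧
      ∀ y ∈ t, HasSum (fun i => inner 𝕜 (e i) y • e i) y := by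
  let U := (Submodule.span 𝕜 t).topologicalClosure
  have : CompleteSpace U := (Submodule.span 𝕜 t).isClosed_topologicalClosure.completeSpace_coe
  have : TopologicalSpace.SeparableSpace U := (ht.span (R := 𝕜)).closure.separableSpace
  obtain ⟨w, b, -⟩ := exists_hilbertBasis 𝕜 U
  refine ⟨w, countable_of_orthonormal b.orthonormal, fun i => b i,
    b.orthonormal.comp_linearIsometry U.subtypeₗᵢ, fun y hy => ?_⟩
  have hyU : y ∈ U := Submodule.le_topologicalClosure _ (Submodule.subset_span hy)
  have h := (b.hasSum_orthogonalProjectionOnto y).mapL U.subtypeL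
  rwa [Submodule.subtypeL_apply, U.orthogonalProjectionOnto_mem_subspace_eq_self ⟨y, hyU⟩] at h

theorem hasSum_integral_inner_mul_inner {X : Type*} [MeasurableSpace X] {ν : Measure X}
    [Countable ι] (he : Orthonormal 𝕜 e) {u v : X → H}
    (hu : AEStronglyMeasurable u ν) (hv : AEStronglyMeasurable v ν)
    (huv : Integrable (fun x => ‖v x‖ * ‖u x‖) ν)
    (hexp : ∀ᵐ x ∂ν, HasSum (fun i => inner 𝕜 (e i) (u x) • e i) (u x)) :
    HasSum (fun i => ∫ x, inner 𝕜 (v x) (e i) * inner 𝕜 (e i) (u x) ∂ν)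
      (∫ x, inner 𝕜 (v x) (u x) ∂ν) := by
  have hmeas (s : Finset ι) : AEStronglyMeasurable
      (fun x => inner 𝕜 (v x) (∑ i ∈ s, inner 𝕜 (e i) (u x) • e i)) ν :=
    hv.inner (Finset.aestronglyMeasurable_fun_sum s fun i _ =>
      (aestronglyMeasurable_const.inner hu).smul_const (e i))
  have hbound (s : Finset ι) (x : X) :
      ‖inner 𝕜 (v x) (∑ i ∈ s, inner 𝕜 (e i) (u x) • e i)‖ ≤ ‖v x‖ * ‖u x‖ :=
    (norm_inner_le_norm _ _).trans (by gcongr; exact norm_sum_inner_smul_le he s (u x))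
  have hint (i : ι) : Integrable (fun x => inner 𝕜 (v x) (e i) * inner 𝕜 (e i) (u x)) ν := by
    simpa [inner_smul_right, mul_comm] using
      huv.mono' (hmeas {i}) (.of_forall (hbound {i}))
  have hlim : Tendsto (fun s : Finset ι =>
      ∫ x, inner 𝕜 (v x) (∑ i ∈ s, inner 𝕜 (e i) (u x) • e i) ∂ν) atTop
      (𝓝 (∫ x, inner 𝕜 (v x) (u x) ∂ν)) :=
    tendsto_integral_filter_of_dominated_convergence _ (.of_forall hmeas)
      (.of_forall fun s => .of_forall (hbound s)) huv
      (hexp.mono fun x hx => tendsto_const_nhds.inner hx)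
  refine hlim.congr fun s => ?_
  simp only [inner_sum, inner_smul_right, mul_comm (inner 𝕜 (e _) (u _)),
    integral_finsetSum s fun i _ => hint i]

end Orthonormal

section WStarTopology

variable {K : Type*} [NormedAddCommGroup K] [InnerProductSpace ℂ K] {ι κ : Type*}

theorem continuous_wStar_rng_iff {X : Type*} [TopologicalSpace X] {T : X → K →L[ℂ] K} :
    Continuous[_, wStarTopology K] T ↔ ∀ f g : ℕ → K, (Summable fun n => ‖f n‖ ^ 2) →
      (Summable fun n => ‖g n‖ ^ 2) → Continuous fun x => ∑' n, inner ℂ (g n) (T x (f n)) := by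
  simp only [continuous_iInf_rng, continuous_induced_rng]
  rfl

theorem tendsto_wStar_iff {X : Type*} {l : Filter X} {u : X → K →L[ℂ] K} {x : K →L[ℂ] K} :
    Tendsto u l (@nhds _ (wStarTopology K) x) ↔
      ∀ f g : ℕ → K, (Summable fun n => ‖f n‖ ^ 2) → (Summable fun n => ‖g n‖ ^ 2) →
        Tendsto (fun i => ∑' n, inner ℂ (g n) (u i (f n))) l
          (𝓝 (∑' n, inner ℂ (g n) (x (f n)))) := by
  simp only [nhds_iInf, nhds_induced, tendsto_iInf, tendsto_comap_iff]
  rfl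

theorem continuous_wStar_tsum_inner_of_countable [Countable κ] {f g : κ → K}
    (hf : Summable fun n => ‖f n‖ ^ 2) (hg : Summable fun n => ‖g n‖ ^ 2) :
    Continuous[wStarTopology K, inferInstance]
      fun x : K →L[ℂ] K => ∑' n, inner ℂ (g n) (x (f n)) := by
  obtain ⟨j, hj⟩ := exists_injective_nat κ
  have summable_extend {f : κ → K} (hf : Summable fun n => ‖f n‖ ^ 2) :
      Summable fun n => ‖Function.extend j f 0 n‖ ^ 2 := by
    refine (hj.summable_iff fun n hn => ?_).1 (by simpa only [Function.comp_def, hj.extend_apply])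
    simp [Function.extend_apply' _ _ _ hn]
  have tsum_extend (x : K →L[ℂ] K) : ∑' n, inner ℂ (g n) (x (f n)) =
      ∑' n, inner ℂ (Function.extend j g 0 n) (x (Function.extend j f 0 n)) := by
    rw [← hj.tsum_eq]
    · simp only [hj.extend_apply]
    · refine Function.support_subset_iff'.2 fun n hn => ?_
      simp [Function.extend_apply' g _ _ hn]
  simp only [tsum_extend]
  exact (@continuous_wStar_rng_iff _ _ _ _ (wStarTopology K) id).1
    (@continuous_id _ (wStarTopology K)) _ _ (summable_extend hf) (summable_extend hg)

theorem continuous_wStar_tsum_inner {f g : κ → K}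
    (hf : Summable fun n => ‖f n‖ ^ 2) (hg : Summable fun n => ‖g n‖ ^ 2) :
    Continuous[wStarTopology K, inferInstance]
      fun x : K →L[ℂ] K => ∑' n, inner ℂ (g n) (x (f n)) := by
  let S : Set κ := Function.support fun n => ‖f n‖ ^ 2
  have hS : Countable S := hf.countable_support
  have tsum_S (x : K →L[ℂ] K) :
      ∑' n, inner ℂ (g n) (x (f n)) = ∑' n : S, inner ℂ (g n) (x (f n)) := by
    refine (tsum_subtype_eq_of_support_subset (Function.support_subset_iff'.2 fun n hn => ?_)).symm
    have : f n = 0 := by simpa [S] using hn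
    simp [this]
  simp only [tsum_S]
  exact continuous_wStar_tsum_inner_of_countable (hf.subtype S) (hg.subtype S)

theorem continuous_wStar_inner_apply (y z : K) :
    Continuous[wStarTopology K, inferInstance] fun x : K →L[ℂ] K => inner ℂ z (x y) := by
  simpa using continuous_wStar_tsum_inner (f := fun _ : Unit => y) (g := fun _ => z)
    (.of_finite) (.of_finite)

theorem tendsto_wStar_of_norm_le {X : Type*} {l : Filter X} {u : X → K →L[ℂ] K} {x : K →L[ℂ] K}
    {C : ℝ} (hu : ∀ i, ‖u i‖ ≤ C)
    (hux : ∀ y z, Tendsto (fun i => inner ℂ z (u i y)) l (𝓝 (inner ℂ z (x y)))) :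
    Tendsto u l (@nhds _ (wStarTopology K) x) := by
  refine tendsto_wStar_iff.2 fun f g hf hg => ?_
  refine tendsto_tsum_of_dominated_convergence ((summable_norm_mul_norm hg hf).mul_left C)
    (fun n => hux (f n) (g n)) (.of_forall fun i n => ?_)
  calc ‖inner ℂ (g n) (u i (f n))‖ ≤ ‖g n‖ * ‖u i (f n)‖ := norm_inner_le_norm _ _
    _ ≤ ‖g n‖ * (C * ‖f n‖) := by gcongr; exact (u i).le_of_opNorm_le (hu i) _
    _ = C * (‖g n‖ * ‖f n‖) := by ring

variable [CompleteSpace K]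

theorem isWStarContinuous_sandwich (V W : K →L[ℂ] lp (fun _ : ι => K) 2) :
    IsWStarContinuous (sandwich V W) := by
  refine (@continuous_wStar_rng_iff _ _ _ _ (wStarTopology K) _).2 fun f g hf hg => ?_
  have hf' := summable_norm_sq_prod (summable_norm_sq_apply hf W)
  have hg' := summable_norm_sq_prod (summable_norm_sq_apply hg V)
  have tsum_eq (x : K →L[ℂ] K) : ∑' n, inner ℂ (g n) (sandwich V W x (f n)) =
      ∑' p : ℕ × ι, inner ℂ (V (g p.1) p.2) (x (W (f p.1) p.2)) := by
    have hsum : Summable fun p : ℕ × ι => inner ℂ (V (g p.1) p.2) (x (W (f p.1) p.2)) :=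
      .of_norm_bounded (summable_norm_mul_norm hg' (summable_norm_sq_apply hf' x))
        fun p => norm_inner_le_norm _ _
    simp only [hsum.tsum_prod, (hasSum_inner_sandwich V W x _ _).tsum_eq]
  simp only [tsum_eq]
  exact continuous_wStar_tsum_inner hf' hg'

theorem tendsto_wStar_sum_rankOne (e : HilbertBasis κ ℂ K) (x : K →L[ℂ] K) :
    Tendsto (fun s : Finset κ => ∑ i ∈ s, InnerProductSpace.rankOne ℂ (e i) (adjoint x (e i)))
      atTop (@nhds _ (wStarTopology K) x) := by
  have sum_apply (s : Finset κ) (y : K) :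
      (∑ i ∈ s, InnerProductSpace.rankOne ℂ (e i) (adjoint x (e i))) y =
        ∑ i ∈ s, inner ℂ (e i) (x y) • e i := by
    simp [adjoint_inner_left]
  refine tendsto_wStar_of_norm_le (C := ‖x‖) (fun s => ?_) fun y z => ?_
  · refine opNorm_le_bound _ (norm_nonneg x) fun y => ?_
    rw [sum_apply]
    exact (norm_sum_inner_smul_le e.orthonormal s (x y)).trans (x.le_opNorm y)
  · simp only [sum_apply, ← e.repr_apply_apply]
    exact tendsto_const_nhds.inner (e.hasSum_repr (x y))

theorem eq_of_isWStarContinuous_of_rankOne {S T : (K →L[ℂ] K) →ₗ[ℂ] (K →L[ℂ] K)}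
    (hS : IsWStarContinuous S) (hT : IsWStarContinuous T)
    (h : ∀ u v : K, S (InnerProductSpace.rankOne ℂ u v) = T (InnerProductSpace.rankOne ℂ u v)) :
    S = T := by
  obtain ⟨w, e, -⟩ := exists_hilbertBasis ℂ K
  refine LinearMap.ext fun x => ContinuousLinearMap.ext fun y => ext_inner_left ℂ fun z => ?_
  have hlim {U : (K →L[ℂ] K) →ₗ[ℂ] (K →L[ℂ] K)} (hU : IsWStarContinuous U) :
      Tendsto (fun s : Finset w => ∑ i ∈ s,
        inner ℂ z (U (InnerProductSpace.rankOne ℂ (e i) (adjoint x (e i))) y))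
        atTop (𝓝 (inner ℂ z (U x y))) := by
    have hcont := @Continuous.comp _ _ _ (wStarTopology K) (wStarTopology K) _ _ _
      (continuous_wStar_inner_apply y z) hU
    have := (@Continuous.tendsto _ _ (wStarTopology K) _ _ hcont x).comp
      (tendsto_wStar_sum_rankOne e x)
    simpa only [Function.comp_def, map_sum, _root_.sum_apply, inner_sum] using this
  have hlimS := hlim hS
  simp only [h] at hlimS
  exact tendsto_nhds_unique hlimS (hlim hT)

end WStarTopology

section Multiplication

variable {Ω : Type*} [MeasurableSpace Ω] {μ : Measure Ω} {𝕜 : Type*} [RCLike 𝕜]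
  {p : ℝ≥0∞} [Fact (1 ≤ p)]

theorem ae_norm_le_norm {E : Type*} [NormedAddCommGroup E] (γ : Lp E ∞ μ) :
    ∀ᵐ t ∂μ, ‖γ t‖ ≤ ‖γ‖ := by
  rw [Lp.norm_def, toReal_eLpNorm (Lp.aestronglyMeasurable γ)]
  exact ae_le_lpNorm_exponent_top (Lp.memLp γ)

theorem integrable_norm_sq {E : Type*} [NormedAddCommGroup E] (f : Lp E 2 μ) :
    Integrable (fun t => ‖f t‖ ^ 2) μ :=
  (memLp_two_iff_integrable_sq_norm (Lp.aestronglyMeasurable f)).1 (Lp.memLp f)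

theorem norm_sq_eq_integral {E : Type*} [NormedAddCommGroup E] (f : Lp E 2 μ) :
    ‖f‖ ^ 2 = ∫ t, ‖f t‖ ^ 2 ∂μ := by
  have h := lpNorm_eq_integral_norm_rpow_toReal (p := 2) (by norm_num) (by norm_num)
    (Lp.aestronglyMeasurable f)
  simp only [ENNReal.toReal_ofNat, Real.rpow_ofNat, ← one_div, ← Real.sqrt_eq_rpow] at h
  rw [Lp.norm_def, toReal_eLpNorm (Lp.aestronglyMeasurable f), h,
    Real.sq_sqrt (integral_nonneg fun _ => by positivity)]

theorem memLp_two_mul_prod {Ω' R : Type*} [MeasurableSpace Ω'] {ν : Measure Ω'}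
    [NormedDivisionRing R] {u : Ω → R} {v : Ω' → R} (hu : MemLp u 2 μ) (hv : MemLp v 2 ν) :
    MemLp (fun p : Ω × Ω' => u p.1 * v p.2) 2 (μ.prod ν) := by
  have hmeas : AEStronglyMeasurable (fun p : Ω × Ω' => u p.1 * v p.2) (μ.prod ν) :=
    hu.aestronglyMeasurable.comp_fst.mul hv.aestronglyMeasurable.comp_snd
  rw [memLp_two_iff_integrable_sq_norm hmeas]
  simp only [norm_mul, mul_pow]
  exact ((memLp_two_iff_integrable_sq_norm hu.aestronglyMeasurable).1 hu).mul_prod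
    ((memLp_two_iff_integrable_sq_norm hv.aestronglyMeasurable).1 hv)

theorem integrable_kernel_mul {Ω' : Type*} [MeasurableSpace Ω'] {ν : Measure Ω'}
    (f : Lp 𝕜 2 (μ.prod ν)) (k : Lp 𝕜 2 μ) (h : Lp 𝕜 2 ν) :
    Integrable (fun p => f p * (star (k p.1) * h p.2)) (μ.prod ν) :=
  (Lp.memLp f).integrable_mul (memLp_two_mul_prod (Lp.memLp k).star (Lp.memLp h))

/-- Multiplication by the essentially bounded function `c`, as an operator on `Lᵖ`. -/
noncomputable def mulOp {c : Ω → 𝕜} (hc : MemLp c ∞ μ) : Lp 𝕜 p μ →L[𝕜] Lp 𝕜 p μ :=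
  (ContinuousLinearMap.mul 𝕜 𝕜).holderL μ ∞ p p hc.toLp

theorem coeFn_mulOp {c : Ω → 𝕜} (hc : MemLp c ∞ μ) (h : Lp 𝕜 p μ) :
    mulOp hc h =ᵐ[μ] fun t => c t * h t := by
  filter_upwards [(ContinuousLinearMap.mul 𝕜 𝕜).coeFn_holder (r := p) hc.toLp h, hc.coeFn_toLp]
    with t hmul hct
  rw [← hct]
  exact hmul

theorem mulOp_eq_one_iff [SigmaFinite μ] {c : Ω → 𝕜} (hc : MemLp c ∞ μ) :
    (mulOp hc : Lp 𝕜 p μ →L[𝕜] Lp 𝕜 p μ) = 1 ↔ ∀ᵐ t ∂μ, c t = 1 := by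
  constructor
  · refine fun hone => ae_of_forall_measure_lt_top_ae_restrict _ fun s hs hμs => ?_
    rw [ae_restrict_iff' hs]
    have hmul := coeFn_mulOp (p := p) hc (indicatorConstLp p hs hμs.ne 1)
    rw [hone, one_apply_eq_self] at hmul
    filter_upwards [hmul, indicatorConstLp_coeFn (p := p) (hs := hs) (hμs := hμs.ne) (c := (1 : 𝕜))]
      with t hmul hind ht
    simpa [hind, ht, eq_comm] using hmul
  · refine fun hc1 => ContinuousLinearMap.ext fun h => Lp.ext ?_
    filter_upwards [coeFn_mulOp hc h, hc1] with t hmul ht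
    rw [hmul, ht, one_mul, one_apply_eq_self]

variable {H : Type*} [NormedAddCommGroup H] [InnerProductSpace 𝕜 H] {ι : Type*} {e : ι → H}

theorem memLp_top_inner (α β : Lp H ∞ μ) : MemLp (fun t => inner 𝕜 (β t) (α t)) ∞ μ := by
  refine memLp_top_of_bound ((Lp.aestronglyMeasurable β).inner (Lp.aestronglyMeasurable α))
    (‖β‖ * ‖α‖) ?_
  filter_upwards [ae_norm_le_norm α, ae_norm_le_norm β] with t hα hβ
  exact (norm_inner_le_norm _ _).trans (by gcongr)

theorem sum_norm_mulOp_inner_sq_le (he : Orthonormal 𝕜 e) (γ : Lp H ∞ μ) (s : Finset ι)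
    (h : Lp 𝕜 2 μ) :
    ∑ i ∈ s, ‖mulOp ((Lp.memLp γ).inner_const (𝕜 := 𝕜) (e i)) h‖ ^ 2 ≤ (‖γ‖ * ‖h‖) ^ 2 := by
  rw [mul_pow]
  simp only [norm_sq_eq_integral]
  rw [← integral_finsetSum _ fun i _ => integrable_norm_sq _, ← integral_const_mul]
  refine integral_mono_ae (integrable_finsetSum _ fun i _ => integrable_norm_sq _)
    ((integrable_norm_sq h).const_mul _) ?_
  have hmul : ∀ᵐ t ∂μ, ∀ i ∈ s, mulOp ((Lp.memLp γ).inner_const (𝕜 := 𝕜) (e i)) h t =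
      inner 𝕜 (γ t) (e i) * h t :=
    (ae_ball_iff s.countable_toSet).2 fun i _ => coeFn_mulOp _ h
  filter_upwards [hmul, ae_norm_le_norm γ] with t ht hγ
  calc ∑ i ∈ s, ‖mulOp ((Lp.memLp γ).inner_const (𝕜 := 𝕜) (e i)) h t‖ ^ 2
      = (∑ i ∈ s, ‖inner 𝕜 (e i) (γ t)‖ ^ 2) * ‖h t‖ ^ 2 := by
        rw [Finset.sum_mul]
        exact Finset.sum_congr rfl fun i hi => by rw [ht i hi, norm_mul, norm_inner_symm, mul_pow]
    _ ≤ ‖γ‖ ^ 2 * ‖h t‖ ^ 2 := by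
        gcongr
        exact (he.sum_inner_products_le (γ t)).trans (by gcongr)

/-- The operator `h ↦ (⟨γ, e i⟩ h)ᵢ` from `L²` to `ℓ²(ι, L²)`, which multiplies `h` by the
conjugated coordinates of `γ` in the orthonormal family `e`. -/
noncomputable def coordColumn (he : Orthonormal 𝕜 e) (γ : Lp H ∞ μ) :
    Lp 𝕜 2 μ →L[𝕜] lp (fun _ : ι => Lp 𝕜 2 μ) 2 :=
  column (fun i => mulOp ((Lp.memLp γ).inner_const (e i))) (norm_nonneg γ)
    (sum_norm_mulOp_inner_sq_le he γ)

theorem coeFn_coordColumn (he : Orthonormal 𝕜 e) (γ : Lp H ∞ μ) (h : Lp 𝕜 2 μ) (i : ι) :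
    coordColumn he γ h i =ᵐ[μ] fun t => inner 𝕜 (γ t) (e i) * h t :=
  coeFn_mulOp _ h

/-- The candidate `T ↦ V_α* (T ⊗ 1) V_β` for the extension of the Schur multiplier with symbol
`(s, t) ↦ ⟨β t, α s⟩`, where `V_γ` is `coordColumn he γ`. -/
noncomputable def schurExtension (he : Orthonormal 𝕜 e) (α β : Lp H ∞ μ) :
    (Lp 𝕜 2 μ →L[𝕜] Lp 𝕜 2 μ) →ₗ[𝕜] (Lp 𝕜 2 μ →L[𝕜] Lp 𝕜 2 μ) :=
  sandwich (coordColumn he α) (coordColumn he β)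

/-- The identity is the case `p = q = id`, `w = 1` of the operators `T` considered here, and the
Hilbert-Schmidt operator with kernel `w` is the case of the two projections `p, q` of `Ω × Ω`. -/
theorem inner_schurExtension {X : Type*} [MeasurableSpace X] {ν : Measure X} [Countable ι]
    (he : Orthonormal 𝕜 e) {α β : Lp H ∞ μ}
    (hexp : ∀ᵐ t ∂μ, HasSum (fun i => inner 𝕜 (e i) (α t) • e i) (α t))
    {p q : X → Ω} (hp : Measure.QuasiMeasurePreserving p ν μ)
    (hq : Measure.QuasiMeasurePreserving q ν μ)
    {w : X → 𝕜} {T : Lp 𝕜 2 μ →L[𝕜] Lp 𝕜 2 μ}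
    (hw : ∀ k h : Lp 𝕜 2 μ, Integrable (fun x => w x * (star (k (p x)) * h (q x))) ν)
    (hT : ∀ k h, inner 𝕜 k (T h) = ∫ x, w x * (star (k (p x)) * h (q x)) ∂ν) (k h : Lp 𝕜 2 μ) :
    inner 𝕜 k (schurExtension he α β T h) =
      ∫ x, inner 𝕜 (β (q x)) (α (p x)) * (w x * (star (k (p x)) * h (q x))) ∂ν := by
  let a (x : X) : 𝕜 := w x * (star (k (p x)) * h (q x))
  have ha : Integrable a ν := hw k h
  have hα : AEStronglyMeasurable (fun x => α (p x)) ν :=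
    (Lp.aestronglyMeasurable α).comp_quasiMeasurePreserving hp
  have hβ : AEStronglyMeasurable (fun x => β (q x)) ν :=
    (Lp.aestronglyMeasurable β).comp_quasiMeasurePreserving hq
  have haα : AEStronglyMeasurable (fun x => a x • α (p x)) ν := ha.aestronglyMeasurable.smul hα
  have hbound : Integrable (fun x => ‖β (q x)‖ * ‖a x • α (p x)‖) ν := by
    refine (ha.norm.const_mul (‖β‖ * ‖α‖)).mono' (hβ.norm.mul haα.norm) ?_
    filter_upwards [hp.ae (ae_norm_le_norm α), hq.ae (ae_norm_le_norm β)] with x hαx hβx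
    rw [norm_mul, norm_norm, norm_norm, norm_smul]
    calc ‖β (q x)‖ * (‖a x‖ * ‖α (p x)‖) ≤ ‖β‖ * (‖a x‖ * ‖α‖) := by gcongr
      _ = ‖β‖ * ‖α‖ * ‖a x‖ := by ring
  have hexp_smul : ∀ᵐ x ∂ν,
      HasSum (fun i => inner 𝕜 (e i) (a x • α (p x)) • e i) (a x • α (p x)) := by
    filter_upwards [hp.ae hexp] with x hx
    simpa only [inner_smul_right, mul_smul] using hx.const_smul (a x)
  refine (hasSum_inner_sandwich _ _ T k h).unique ?_
  convert hasSum_integral_inner_mul_inner he haα hβ hbound hexp_smul using 1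
  · ext i
    rw [hT]
    refine integral_congr_ae ?_
    filter_upwards [hp.ae (coeFn_coordColumn he α k i), hq.ae (coeFn_coordColumn he β h i)]
      with x hk hh
    simp only [hk, hh, a, ← starRingEnd_apply, map_mul, inner_conj_symm, inner_smul_right]
    ring
  · simp only [inner_smul_right, a, mul_comm]

theorem schurExtension_one [Countable ι] (he : Orthonormal 𝕜 e) {α β : Lp H ∞ μ}
    (hexp : ∀ᵐ t ∂μ, HasSum (fun i => inner 𝕜 (e i) (α t) • e i) (α t)) :
    schurExtension he α β (1 : Lp 𝕜 2 μ →L[𝕜] Lp 𝕜 2 μ) = mulOp (memLp_top_inner α β) := by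
  have inner_eq (k : Lp 𝕜 2 μ) (h : Lp 𝕜 2 μ) (t : Ω) :
      inner 𝕜 (k t) (h t) = 1 * (star (k t) * h t) := by
    rw [RCLike.inner_apply', one_mul, starRingEnd_apply]
  refine ContinuousLinearMap.ext fun h => ext_inner_left 𝕜 fun k => ?_
  rw [inner_schurExtension he hexp (.id μ) (.id μ) (w := 1)
    (fun k h => (L2.integrable_inner k h).congr (.of_forall (inner_eq k h)))
    (fun k h => integral_congr_ae (.of_forall (inner_eq k h))), L2.inner_def]
  refine integral_congr_ae ?_
  filter_upwards [coeFn_mulOp (memLp_top_inner α β) h] with t ht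
  simp only [ht, RCLike.inner_apply', ← starRingEnd_apply, id_eq, Pi.one_apply]
  ring

end Multiplication

section Kernel

variable {Ω : Type*} [MeasurableSpace Ω] {μ : Measure Ω} [SigmaFinite μ]

theorem inner_kernelOp (f : Lp ℂ 2 (μ.prod μ)) (k h : Lp ℂ 2 μ) :
    inner ℂ k (kernelOp f h) = ∫ p, f p * (star (k p.1) * h p.2) ∂(μ.prod μ) := by
  rw [integral_prod _ (integrable_kernel_mul f k h), L2.inner_def]
  refine integral_congr_ae ?_
  filter_upwards [(memLp_kernel (Lp.memLp f) (Lp.memLp h)).coeFn_toLp] with s hs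
  change inner ℂ (k s) (kernelFun f h s) = _
  rw [kernelFun, hs, RCLike.inner_apply, ← integral_mul_const]
  refine integral_congr_ae (.of_forall fun t => ?_)
  simp only [starRingEnd_apply]
  ring

theorem exists_kernelOp_eq_rankOne (u v : Lp ℂ 2 μ) :
    ∃ f : Lp ℂ 2 (μ.prod μ), kernelOp f = InnerProductSpace.rankOne ℂ u v := by
  have hf : MemLp (fun p : Ω × Ω => u p.1 * star (v p.2)) 2 (μ.prod μ) :=
    memLp_two_mul_prod (Lp.memLp u) (Lp.memLp v).star
  refine ⟨hf.toLp, ContinuousLinearMap.ext fun h => ext_inner_left ℂ fun k => ?_⟩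
  rw [inner_kernelOp, InnerProductSpace.rankOne_apply, inner_smul_right, L2.inner_def, L2.inner_def,
    mul_comm, ← integral_prod_mul]
  refine integral_congr_ae ?_
  filter_upwards [hf.coeFn_toLp] with p hp
  simp only [hp, RCLike.inner_apply, starRingEnd_apply]
  ring

theorem IsWStarExtension.unique {φ : Lp ℂ ∞ (μ.prod μ)}
    {S T : (Lp ℂ 2 μ →L[ℂ] Lp ℂ 2 μ) →ₗ[ℂ] (Lp ℂ 2 μ →L[ℂ] Lp ℂ 2 μ)}
    (hS : IsWStarExtension φ S) (hT : IsWStarExtension φ T) : S = T := by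
  refine eq_of_isWStarContinuous_of_rankOne hS.wStarContinuous hT.wStarContinuous fun u v => ?_
  obtain ⟨f, hf⟩ := exists_kernelOp_eq_rankOne u v
  rw [← hf, hS.extends_schur, hT.extends_schur]

variable {H : Type*} [NormedAddCommGroup H] [InnerProductSpace ℂ H]
  {ι : Type*} [Countable ι] {e : ι → H} {α β : Lp H ∞ μ} {φ : Lp ℂ ∞ (μ.prod μ)}

theorem schurExtension_kernelOp (he : Orthonormal ℂ e)
    (hexp : ∀ᵐ t ∂μ, HasSum (fun i => inner ℂ (e i) (α t) • e i) (α t))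
    (hφ : ∀ᵐ p ∂(μ.prod μ), φ p = inner ℂ (β p.2) (α p.1)) (f : Lp ℂ 2 (μ.prod μ)) :
    schurExtension he α β (kernelOp f) = kernelOp (φ • f : Lp ℂ 2 (μ.prod μ)) := by
  refine ContinuousLinearMap.ext fun h => ext_inner_left ℂ fun k => ?_
  rw [inner_schurExtension he hexp Measure.quasiMeasurePreserving_fst
    Measure.quasiMeasurePreserving_snd (integrable_kernel_mul f) (inner_kernelOp f), inner_kernelOp]
  refine integral_congr_ae ?_
  filter_upwards [hφ, Lp.coeFn_lpSMul (r := 2) φ f] with p hφp hsmul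
  rw [hsmul, Pi.smul_apply', hφp, smul_eq_mul, mul_assoc]

theorem isWStarExtension_schurExtension (he : Orthonormal ℂ e)
    (hexp : ∀ᵐ t ∂μ, HasSum (fun i => inner ℂ (e i) (α t) • e i) (α t))
    (hφ : ∀ᵐ p ∂(μ.prod μ), φ p = inner ℂ (β p.2) (α p.1)) :
    IsWStarExtension φ (schurExtension he α β) :=
  ⟨isWStarContinuous_sandwich _ _, schurExtension_kernelOp he hexp hφ⟩

end Kernel

end SchurMult

theorem mainTheorem9 {Ω : Type*} [MeasurableSpace Ω] (μ : Measure Ω) [SigmaFinite μ]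
    {H : Type*} [NormedAddCommGroup H] [InnerProductSpace ℂ H] [CompleteSpace H]
    (φ : Lp ℂ ∞ (μ.prod μ)) (α β : Lp H ∞ μ)
    (hφ : ∀ᵐ p ∂(μ.prod μ), φ p = inner ℂ (β p.2) (α p.1)) :
    ∃ M : (Lp ℂ 2 μ →L[ℂ] Lp ℂ 2 μ) →ₗ[ℂ] (Lp ℂ 2 μ →L[ℂ] Lp ℂ 2 μ),
      SchurMult.IsWStarExtension φ M ∧
      (∀ M' : (Lp ℂ 2 μ →L[ℂ] Lp ℂ 2 μ) →ₗ[ℂ] (Lp ℂ 2 μ →L[ℂ] Lp ℂ 2 μ),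
        SchurMult.IsWStarExtension φ M' → M' = M) ∧
      (M 1 = 1 ↔ ∀ᵐ t ∂μ, inner ℂ (β t) (α t) = 1) := by
  obtain ⟨t, ht, hαt⟩ := (Lp.aestronglyMeasurable α).isSeparable_ae_range
  obtain ⟨ι, _, e, he, het⟩ := SchurMult.exists_countable_orthonormal_hasSum (𝕜 := ℂ) ht
  have hexp := hαt.mono fun s hs => het (α s) hs
  have hM := SchurMult.isWStarExtension_schurExtension he hexp hφ
  refine ⟨_, hM, fun M' hM' => hM'.unique hM, ?_⟩
  rw [SchurMult.schurExtension_one he hexp, SchurMult.mulOp_eq_one_iff]
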